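/- **Setting.** Transmitters $\mathcal I=\{0,1,\dots,N_B\}$ ($0$ is the HAPS, the others are ground base stations) serve single-antenna users $\mathcal U=\{1,\dots,N_U\}$. The association is fixed: $\gamma_{ij},\alpha_{ij}\in\{0,1\}$ with $\sum_i\gamma_{ij}\alpha_{ij}\le 1$ for every $j$; put $\mathcal U_i=\{j:\gamma_{ij}\alpha_{ij}=1\}$, and call $(i,j)$ with $j\in\mathcal U_i$ a link. Given are channels $\mathbf h_{ij}\in\mathbb C^{N_A^i}$, noise variance $\sigma^2>0$, bandwidth $\beta>0$, power budgets $P_i^{max}\ge 0$ and an FSO backhaul capacity $R^{FSO}>0$. For beamformers $\mathbf w=(\mathbf w_{ij})$, $\mathbf w_{ij}\in\mathbb C^{N_A^i}$, indexed by the links, let $$R_{ij}=\beta\log_2\Bigl(1+\frac{|\mathbf h_{ij}^H\mathbf w_{ij}|^2}{\sum_{(b,l):\,l\in\mathcal U_b,\ l\ne j}|\mathbf h_{bj}^H\mathbf w_{bl}|^2+\sigma^2}\Bigr),\qquad \tau_{0j}=\min\{R_{0j},R^{FSO}\}.$$ The beamforming problem is $$\max_{\mathbf w}\ R_{sum}(\mathbf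 w)=\sum_{i\ne 0}\sum_{j\in\mathcal U_i}R_{ij}+\sum_{j\in\mathcal U_0}\tau_{0j}\quad\text{s.t.}\quad \sum_{j\in\mathcal U_i}\|\mathbf w_{ij}\|^2\le P_i^{max}\ \ \forall i\in\mathcal I .\tag{P}$$ A feasible $\mathbf x$ is a *stationary point* of (P) if for every feasible $\mathbf y$ the one-sided directional derivative of $R_{sum}$ at $\mathbf x$ in the direction $\mathbf y-\mathbf x$ exists and is $\le 0$. **Algorithm (modified WMMSE).** From an arbitrary initial $\mathbf w^0$, repeat for $m=0,1,2,\dots$: 1. weights: $\lambda_{ij}=1$ for $i\neq0$; $\lambda_{0j}=1$ if $\tau_{0j}=R_{0j}$ and $\lambda_{0j}=0$ if $\tau_{0j}=R^{FSO}$ (either value in case of a tie), evaluated at $\mathbf w^m$; 2. MMSE receivers: $u_{ij}=\mathbf h_{ij}^H\mathbf w_{ij}^m\big/\bigl(\sum_{b}\sum_{l\in\mathcal U_b}|\mathbf h_{bj}^H\mathbf w_{bl}^m|^2+\sigma^2\bigr)$; 3. MSE weights: $\rho_{ij}=e_{ij}^{-1}$, where $e_{ij}(u,\mathbf w)=|1-\overline{u_{ij}}\,\mathbf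 h_{ij}^H\mathbf w_{ij}|^2+\sum_{(b,l)\ne(i,j)}|u_{ij}\mathbf h_{bj}^H\mathbf w_{bl}|^2+\sigma^2|u_{ij}|^2$ is evaluated at $(u,\mathbf w^m)$; 4. beamformers: $\mathbf w^{m+1}$ minimizes $\sum_{i}\sum_{j\in\mathcal U_i}\lambda_{ij}\bigl(\rho_{ij}e_{ij}(u,\mathbf w)-\log\rho_{ij}\bigr)$ over the feasible $\mathbf w$ with $\lambda,\rho,u$ fixed. If there are several minimizers, one is taken that wastes no power on the HAPS links: if replacing $\mathbf w^{m+1}_{0j}$ by $0$ does not change the value of this objective, then $\mathbf w^{m+1}_{0j}=0$. **Lemma 1.** For a fixed user association and every initial $\mathbf w^0$, the algorithm has an infinite run from $\mathbf w^0$, and every such run $(\mathbf w^m)$ converges to stationary points of (P) in the following sense: $(\mathbf w^m)$ has a limit point; $R_{sum}(\mathbf w^m)$ converges to some $L\in\mathbb R$; every limit point $\mathbf x$ of $(\mathbf w^m)$ is a stationary point of (P) with $R_{sum}(\mathbf x)=L$; and the distance of $\mathbf w^m$ to the set of stationary points of (P) tends to $0$. -/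

import Mathlib

open Filter Topology

noncomputable section

/-- A downlink network with a fixed user association. Transmitter `0` is the HAPS, the transmitters
`1, …, NB` are the ground base stations, and users have a single receive antenna. -/
structure Network where
  /-- number of ground base stations -/
  NB : ℕ
  /-- number of users -/
  NU : ℕ
  /-- number of antennas of each transmitter -/
  antennas : Fin (NB + 1) → ℕ
  /-- data availability -/
  γ : Fin (NB + 1) → Fin NU → Bool
  /-- user association -/
  α : Fin (NB + 1) → Fin NU → Bool
  /-- each user is served by at most one transmitter -/
  single : ∀ j, ∑ i, (γ i j && α i j).toNat ≤ 1
  /-- channel vectors -/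
  h : ∀ i, Fin NU → EuclideanSpace ℂ (Fin (antennas i))
  /-- noise standard deviation -/
  σ : ℝ
  σ_pos : 0 < σ
  /-- transmission bandwidth -/
  β : ℝ
  β_pos : 0 < β
  /-- power budgets -/
  Pmax : Fin (NB + 1) → ℝ
  Pmax_nonneg : ∀ i, 0 ≤ Pmax i
  /-- capacity of the FSO backhaul link of the HAPS -/
  RFSO : ℝ
  RFSO_pos : 0 < RFSO

namespace Network

variable (N : Network)

/-- The active links: pairs (transmitter `i`, user `j`) such that `i` serves `j`. -/
abbrev Link : Type :=
  {p : Fin (N.NB + 1) × Fin N.NU // (N.γ p.1 p.2 && N.α p.1 p.2) = true}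

variable {N}

/-- The transmitter of a link. -/
abbrev Link.tx (p : N.Link) : Fin (N.NB + 1) := p.1.1

/-- The user of a link. -/
abbrev Link.user (p : N.Link) : Fin N.NU := p.1.2

variable (N)

/-- Families of transmit beamforming vectors, one for each active link. -/
abbrev Beams : Type := ∀ p : N.Link, EuclideanSpace ℂ (Fin (N.antennas p.tx))

variable {N}

/-- The complex gain `h_{bj}ᴴ w_{bl}` with which the signal of the link `q = (b, l)` is received by
user `j`. -/
def gain (w : N.Beams) (q : N.Link) (j : Fin N.NU) : ℂ :=
  inner ℂ (N.h q.tx j) (w q)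

/-- Signal-to-interference-plus-noise ratio. -/
def sinr (w : N.Beams) (p : N.Link) : ℝ :=
  ‖gain w p p.user‖ ^ 2 /
    (∑ q : N.Link with q.user ≠ p.user, ‖gain w q p.user‖ ^ 2 + N.σ ^ 2)

/-- Achievable RF rate. -/
def rate (w : N.Beams) (p : N.Link) : ℝ :=
  N.β * Real.logb 2 (1 + sinr w p)

/-- Rate of a HAPS link, capped by the FSO backhaul. -/
def tau (w : N.Beams) (p : N.Link) : ℝ :=
  min (rate w p) N.RFSO

/-- The objective of the beamforming problem: the network sum-rate. -/
def sumRate (w : N.Beams) : ℝ :=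
  ∑ p : N.Link, if p.tx = 0 then tau w p else rate w p

variable (N)

/-- The beamformers that satisfy all the power constraints. -/
def feasible : Set N.Beams :=
  {w | ∀ i, ∑ p : N.Link with p.tx = i, ‖w p‖ ^ 2 ≤ N.Pmax i}

variable {N}

/-- First-order stationarity for the maximization of `sumRate` over the convex set `feasible`: at the
feasible point `x` the one-sided directional derivative of the objective towards each feasible point
exists and is nonpositive. The objective need not be differentiable where a HAPS rate meets the cap. -/
def IsStationary (x : N.Beams) : Prop :=
  x ∈ N.feasible ∧ ∀ y ∈ N.feasible, ∃ D ≤ (0 : ℝ),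
    HasDerivWithinAt (fun t : ℝ => sumRate (x + t • (y - x))) D (Set.Ici 0) 0

/-- The rule for the weights of the rate terms: `1` for ground links; for a HAPS link `1` if
the RF rate attains the minimum and `0` if the FSO rate does (either value if both do). -/
def IsWeight (w : N.Beams) (lam : N.Link → ℝ) : Prop :=
  ∀ p : N.Link,
    (p.tx ≠ 0 → lam p = 1) ∧
    (p.tx = 0 → (lam p = 1 ∧ tau w p = rate w p) ∨ (lam p = 0 ∧ tau w p = N.RFSO))

/-- Mean squared error of a link with (scalar) receivers `u`. -/
def mse (u : N.Link → ℂ) (w : N.Beams) (p : N.Link) : ℝ :=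
  ‖1 - star (u p) * gain w p p.user‖ ^ 2
    + ∑ q : N.Link with q ≠ p, ‖u p * gain w q p.user‖ ^ 2
    + N.σ ^ 2 * ‖u p‖ ^ 2

/-- The objective of the weighted MSE minimization problem. -/
def wmmse (lam ρ : N.Link → ℝ) (u : N.Link → ℂ) (w : N.Beams) : ℝ :=
  ∑ p : N.Link, lam p * (ρ p * mse u w p - Real.log (ρ p))

/-- The MMSE receivers. -/
def mmseReceiver (w : N.Beams) (p : N.Link) : ℂ :=
  gain w p p.user / ((∑ q : N.Link, ‖gain w q p.user‖ ^ 2 + N.σ ^ 2 : ℝ) : ℂ)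

/-- `w` is an outcome of the transmit beamformer update with the weights `lam`, `ρ` and the receivers
`u` held fixed: it is optimal, and it spends no power on a HAPS link that can be switched off
without loss of optimality. -/
def IsBeamUpdate (lam ρ : N.Link → ℝ) (u : N.Link → ℂ) (w : N.Beams) : Prop :=
  IsMinOn (wmmse lam ρ u) N.feasible w ∧ w ∈ N.feasible ∧
    ∀ p : N.Link, p.tx = 0 →
      wmmse lam ρ u (Function.update w p 0) = wmmse lam ρ u w → w p = 0

variable (N)

/-- An infinite run of the modified WMMSE iteration. -/
structure Run where
  w : ℕ → N.Beams
  lam : ℕ → N.Link → ℝ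
  u : ℕ → N.Link → ℂ
  ρ : ℕ → N.Link → ℝ
  weight_step : ∀ m, IsWeight (w m) (lam m)
  receiver_step : ∀ m, u m = mmseReceiver (w m)
  mse_weight_step : ∀ m p, ρ m p = (mse (u m) (w m) p)⁻¹
  beam_step : ∀ m, IsBeamUpdate (lam m) (ρ m) (u m) (w (m + 1))

end Network

end

/-!
A HAPS link of weight `0` contributes nothing to the weighted MSE objective and only disturbs the
other links, so the rule against wasting power switches it off. Its rate is then `0 < RFSO`, so
that its weight is `1` from then on; its MMSE receiver is `0`, so that it stays off. Hence all
weights are eventually `1`: the caps no longer bind, and the iteration is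
majorization–minimization for minus the uncapped sum-rate. This gives convergence of the
objective, and at a limit point the tangent majorant is minimal at its base point, so the
directional derivatives of the uncapped sum-rate are nonpositive. A HAPS rate that reaches the cap
in the limit does no harm, because a right derivative of `min (f t) c` at a point where `f ≤ c` is
at most that of `f`.
-/

theorem hasDerivWithinAt_min_Ici {f g : ℝ → ℝ} {f' g' a : ℝ}
    (hf : HasDerivWithinAt f f' (Set.Ici a) a) (hg : HasDerivWithinAt g g' (Set.Ici a) a)
    (hfg : f a = g a) :
    HasDerivWithinAt (fun t => min (f t) (g t)) (min f' g') (Set.Ici a) a := by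
  rw [← hasDerivWithinAt_Ioi_iff_Ici,
    hasDerivWithinAt_iff_tendsto_slope' Set.self_notMem_Ioi] at hf hg ⊢
  refine (hf.min hg).congr' ?_
  filter_upwards [self_mem_nhdsWithin] with t (ht : a < t)
  simp only [slope_def_field, hfg, min_self, ← min_sub_sub_right]
  exact min_div_div_right (sub_nonneg.2 ht.le) _ _

theorem exists_hasDerivWithinAt_min_const {f : ℝ → ℝ} {f' a c : ℝ}
    (hf : HasDerivWithinAt f f' (Set.Ici a) a) (hc : f a ≤ c) :
    ∃ D ≤ f', HasDerivWithinAt (fun t => min (f t) c) D (Set.Ici a) a := by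
  rcases hc.lt_or_eq with hlt | heq
  · refine ⟨f', le_rfl, hf.congr_of_eventuallyEq ?_ (min_eq_left hc)⟩
    filter_upwards [hf.continuousWithinAt.eventually (gt_mem_nhds hlt)] with t ht
    exact min_eq_left ht.le
  · exact ⟨min f' 0, min_le_left _ _,
      hasDerivWithinAt_min_Ici hf (hasDerivWithinAt_const a _ c) heq⟩

theorem map_eq_of_mapClusterPt {ι X Y : Type*} [TopologicalSpace X] [TopologicalSpace Y]
    [T2Space Y] {l : Filter ι} {x : ι → X} {a : X} {f : X → Y} {b : Y}
    (ha : MapClusterPt a l x) (hf : ContinuousAt f a) (hb : Tendsto (fun i => f (x i)) l (𝓝 b)) :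
    f a = b := by
  obtain ⟨U, hUl, hUa⟩ := mapClusterPt_iff_ultrafilter.1 ha
  exact tendsto_nhds_unique (hf.tendsto.comp hUa) (hb.mono_left hUl)

theorem tendsto_infDist_nhdsSet {X : Type*} [PseudoMetricSpace X] (s : Set X) :
    Tendsto (fun x => Metric.infDist x s) (𝓝ˢ s) (𝓝 0) := by
  refine Metric.tendsto_nhds.2 fun ε hε => ?_
  filter_upwards [Metric.thickening_mem_nhdsSet s hε] with x hx
  obtain ⟨y, hy, hxy⟩ := Metric.mem_thickening_iff.1 hx
  rw [Real.dist_0_eq_abs, abs_of_nonneg Metric.infDist_nonneg]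
  exact (Metric.infDist_le_dist_of_mem hy).trans_lt hxy

/-- `g v` is, for each base point `v`, a majorant of `f` that is exact at `v`. -/
structure IsMajorizer {X : Type*} (f : X → ℝ) (g : X → X → ℝ) : Prop where
  le : ∀ v w, f w ≤ g v w
  self_eq : ∀ v, g v v = f v

namespace IsMajorizer

section Iteration

variable {X : Type*} {f : X → ℝ} {g : X → X → ℝ} {K : Set X} {x : ℕ → X}

theorem le_of_isMinOn (h : IsMajorizer f g) {v w : X} (hv : v ∈ K) (hw : IsMinOn (g v) K w) :
    f w ≤ f v :=
  calc
    f w ≤ g v w := h.le v w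
    _ ≤ g v v := hw hv
    _ = f v := h.self_eq v

theorem exists_tendsto (h : IsMajorizer f g) (hK : BddBelow (f '' K))
    (hxK : ∀ᶠ m in atTop, x m ∈ K) (hx : ∀ᶠ m in atTop, IsMinOn (g (x m)) K (x (m + 1))) :
    ∃ L, Tendsto (fun m => f (x m)) atTop (𝓝 L) := by
  obtain ⟨M, hM⟩ := eventually_atTop.1 (hxK.and hx)
  have hanti : Antitone fun k => f (x (k + M)) := antitone_nat_of_succ_le fun k => by
    rw [Nat.add_right_comm]
    obtain ⟨hmem, hmin⟩ := hM (k + M) (Nat.le_add_left M k)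
    exact h.le_of_isMinOn hmem hmin
  have hbdd : BddBelow (Set.range fun k => f (x (k + M))) := hK.mono <| by
    rintro _ ⟨k, rfl⟩
    exact Set.mem_image_of_mem f (hM (k + M) (Nat.le_add_left M k)).1
  exact ⟨_, (tendsto_add_atTop_iff_nat M).1 (tendsto_atTop_ciInf hanti hbdd)⟩

theorem isMinOn_of_mapClusterPt [TopologicalSpace X] (h : IsMajorizer f g) {a : X} {L : ℝ}
    (hf : ContinuousAt f a) (hg : ∀ y ∈ K, ContinuousAt (fun v => g v y) a)
    (hx : ∀ᶠ m in atTop, IsMinOn (g (x m)) K (x (m + 1)))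
    (hL : Tendsto (fun m => f (x m)) atTop (𝓝 L)) (ha : MapClusterPt a atTop x) :
    IsMinOn (g a) K a := by
  intro y hy
  obtain ⟨U, hU, hUa⟩ := mapClusterPt_iff_ultrafilter.1 ha
  have hsucc : Tendsto (fun m => f (x (m + 1))) U (𝓝 L) :=
    ((tendsto_add_atTop_iff_nat 1).2 hL).mono_left hU
  have hle : ∀ᶠ m in (U : Filter ℕ), f (x (m + 1)) ≤ g (x m) y :=
    (hx.filter_mono hU).mono fun m hm => (h.le _ _).trans (hm hy)
  calc
    g a a = L := (h.self_eq a).trans (map_eq_of_mapClusterPt ha hf hL)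
    _ ≤ g a y := le_of_tendsto_of_tendsto hsucc ((hg y hy).tendsto.comp hUa) hle

end Iteration

section FirstOrder

variable {E : Type*} [NormedAddCommGroup E] [NormedSpace ℝ E] {f : E → ℝ} {g : E → E → ℝ} {a : E}

theorem fderiv_eq (h : IsMajorizer f g) (hf : DifferentiableAt ℝ f a)
    (hg : DifferentiableAt ℝ (g a) a) : fderiv ℝ (g a) a = fderiv ℝ f a := by
  have hmin : IsLocalMin (g a - f) a := Eventually.of_forall fun w => by
    simpa [h.self_eq a] using h.le a w
  rw [← sub_eq_zero, ← fderiv_sub hg hf]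
  exact hmin.fderiv_eq_zero

theorem fderiv_nonneg_of_isMinOn (h : IsMajorizer f g) (hf : DifferentiableAt ℝ f a)
    (hg : DifferentiableAt ℝ (g a) a) {K : Set E} (hK : Convex ℝ K) (ha : a ∈ K)
    (hmin : IsMinOn (g a) K a) {y : E} (hy : y ∈ K) : 0 ≤ fderiv ℝ f a (y - a) := by
  rw [← h.fderiv_eq hf hg]
  exact hmin.localize.hasFDerivWithinAt_nonneg hg.hasFDerivAt.hasFDerivWithinAt
    (sub_mem_posTangentConeAt_of_segment_subset (hK.segment_subset ha hy))

end FirstOrder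

end IsMajorizer

/-- Completing the square in the receiver `u`; the square vanishes at the MMSE receiver. -/
theorem norm_one_sub_star_mul_sq_add {𝕜 : Type*} [RCLike 𝕜] (u g : 𝕜) {J : ℝ} (hJ : 0 < J) :
    ‖1 - star u * g‖ ^ 2 + ‖u‖ ^ 2 * J =
      (1 + ‖g‖ ^ 2 / J)⁻¹ + (‖g‖ ^ 2 + J) * ‖u - g / ((‖g‖ ^ 2 + J : ℝ) : 𝕜)‖ ^ 2 := by
  have hT : 0 < ‖g‖ ^ 2 + J := by positivity
  have hleft : ‖1 - star u * g‖ ^ 2 = 1 - 2 * RCLike.re (star u * g) + ‖u‖ ^ 2 * ‖g‖ ^ 2 := by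
    rw [norm_sub_sq (𝕜 := 𝕜)]
    simp [RCLike.inner_apply, mul_pow]
  have hright : ‖u - g / ((‖g‖ ^ 2 + J : ℝ) : 𝕜)‖ ^ 2 =
      ‖u‖ ^ 2 - 2 * (RCLike.re (star u * g) / (‖g‖ ^ 2 + J)) + ‖g‖ ^ 2 / (‖g‖ ^ 2 + J) ^ 2 := by
    rw [norm_sub_sq (𝕜 := 𝕜), RCLike.inner_apply, div_mul_eq_mul_div, RCLike.div_re_ofReal,
      norm_div, RCLike.norm_ofReal, abs_of_pos hT, div_pow, mul_comm g]
    rfl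
  rw [hleft, hright]
  field_simp
  ring

namespace Network

variable {N : Network}

theorem Link.eq_of_user_eq {p q : N.Link} (h : q.user = p.user) : q = p := by
  by_contra hne
  have htx : q.tx ≠ p.tx := fun e => hne (Subtype.ext (Prod.ext e h))
  have hq : (N.γ q.tx p.user && N.α q.tx p.user) = true := h ▸ q.2
  have htwo := Finset.add_le_sum (s := Finset.univ)
    (f := fun i => (N.γ i p.user && N.α i p.user).toNat) (fun _ _ => Nat.zero_le _)
    (Finset.mem_univ q.tx) (Finset.mem_univ p.tx) htx
  simp only [hq, p.2, Bool.toNat_true] at htwo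
  exact absurd (htwo.trans (N.single p.user)) (by norm_num)

theorem Link.user_ne_iff {p q : N.Link} : q.user ≠ p.user ↔ q ≠ p :=
  not_congr ⟨Link.eq_of_user_eq, congrArg _⟩

/-- Interference plus noise power at the receiver of a link. -/
noncomputable def interference (w : N.Beams) (p : N.Link) : ℝ :=
  ∑ q : N.Link with q ≠ p, ‖gain w q p.user‖ ^ 2 + N.σ ^ 2

theorem interference_pos (w : N.Beams) (p : N.Link) : 0 < interference w p :=
  add_pos_of_nonneg_of_pos (Finset.sum_nonneg fun _ _ => sq_nonneg _) (pow_pos N.σ_pos 2)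

theorem sinr_eq_div_interference (w : N.Beams) (p : N.Link) :
    sinr w p = ‖gain w p p.user‖ ^ 2 / interference w p := by
  simp only [sinr, interference, Link.user_ne_iff]

theorem one_add_sinr_pos (w : N.Beams) (p : N.Link) : 0 < 1 + sinr w p := by
  have := interference_pos w p
  rw [sinr_eq_div_interference]
  positivity

theorem mse_eq_add_interference (u : N.Link → ℂ) (w : N.Beams) (p : N.Link) :
    mse u w p = ‖1 - star (u p) * gain w p p.user‖ ^ 2 + ‖u p‖ ^ 2 * interference w p := by
  simp only [mse, interference, norm_mul, mul_pow, ← Finset.mul_sum]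
  ring

theorem mmseReceiver_eq_div_interference (w : N.Beams) (p : N.Link) :
    mmseReceiver w p =
      gain w p p.user / ((‖gain w p p.user‖ ^ 2 + interference w p : ℝ) : ℂ) := by
  rw [mmseReceiver, interference, ← Finset.add_sum_erase _ _ (Finset.mem_univ p),
    Finset.filter_ne', add_assoc]

theorem mmseReceiver_eq_zero {w : N.Beams} {p : N.Link} (h : w p = 0) : mmseReceiver w p = 0 := by
  simp [mmseReceiver, gain, h]

theorem inv_one_add_sinr_le_mse (u : N.Link → ℂ) (w : N.Beams) (p : N.Link) :
    (1 + sinr w p)⁻¹ ≤ mse u w p := by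
  have hpos := interference_pos w p
  rw [mse_eq_add_interference, norm_one_sub_star_mul_sq_add _ _ hpos, sinr_eq_div_interference]
  exact le_add_of_nonneg_right (by positivity)

theorem mse_mmseReceiver (w : N.Beams) (p : N.Link) :
    mse (mmseReceiver w) w p = (1 + sinr w p)⁻¹ := by
  rw [mse_eq_add_interference, norm_one_sub_star_mul_sq_add _ _ (interference_pos w p),
    sinr_eq_div_interference, mmseReceiver_eq_div_interference]
  simp

theorem one_sub_log_one_add_sinr_le {ρ : ℝ} (hρ : 0 < ρ) (u : N.Link → ℂ) (w : N.Beams)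
    (p : N.Link) : 1 - Real.log (1 + sinr w p) ≤ ρ * mse u w p - Real.log ρ := by
  have hinv : 0 < (1 + sinr w p)⁻¹ := inv_pos.2 (one_add_sinr_pos w p)
  have hle : ρ * (1 + sinr w p)⁻¹ ≤ ρ * mse u w p :=
    mul_le_mul_of_nonneg_left (inv_one_add_sinr_le_mse u w p) hρ.le
  have hlog := Real.log_le_sub_one_of_pos (mul_pos hρ hinv)
  rw [Real.log_mul hρ.ne' hinv.ne', Real.log_inv] at hlog
  linarith

/-- The weighted MSE objective with all rate weights `1`, minimized over the receivers and the MSE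
weights. Up to an affine rescaling it is minus the sum-rate without the backhaul cap. -/
noncomputable def minWmmse (w : N.Beams) : ℝ :=
  ∑ p : N.Link, (1 - Real.log (1 + sinr w p))

theorem minWmmse_le_wmmse {ρ : N.Link → ℝ} (hρ : ∀ p, 0 < ρ p) (u : N.Link → ℂ) (w : N.Beams) :
    minWmmse w ≤ wmmse 1 ρ u w :=
  Finset.sum_le_sum fun p _ => by
    rw [Pi.one_apply, one_mul]
    exact one_sub_log_one_add_sinr_le (hρ p) u w p

/-- The objective that the beam update at `v` minimizes when all rate weights are `1`. -/
noncomputable def surrogate (v w : N.Beams) : ℝ :=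
  wmmse 1 (fun p => (mse (mmseReceiver v) v p)⁻¹) (mmseReceiver v) w

theorem isMajorizer_surrogate : IsMajorizer (minWmmse (N := N)) surrogate where
  le v w := minWmmse_le_wmmse
    (fun p => by rw [mse_mmseReceiver, inv_inv]; exact one_add_sinr_pos v p) _ w
  self_eq v := Finset.sum_congr rfl fun p _ => by
    simp only [Pi.one_apply, one_mul, mse_mmseReceiver, inv_inv,
      mul_inv_cancel₀ (one_add_sinr_pos v p).ne']

theorem rate_eq_mul_log (w : N.Beams) (p : N.Link) :
    rate w p = N.β / Real.log 2 * Real.log (1 + sinr w p) := by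
  rw [rate, Real.logb, mul_div_left_comm, mul_comm, mul_comm_div]

theorem sum_rate_eq_minWmmse (w : N.Beams) :
    ∑ p : N.Link, rate w p = N.β / Real.log 2 * (Fintype.card N.Link - minWmmse w) := by
  simp [rate_eq_mul_log, minWmmse, Finset.mul_sum]

section Regularity

@[fun_prop]
theorem differentiable_gain (q : N.Link) (j : Fin N.NU) :
    Differentiable ℝ fun w : N.Beams => gain w q j :=
  (((innerSL ℂ (N.h q.tx j)).restrictScalars ℝ).comp
    (ContinuousLinearMap.proj (R := ℝ) (φ := fun p : N.Link =>
      EuclideanSpace ℂ (Fin (N.antennas p.tx))) q)).differentiable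

@[fun_prop]
theorem differentiable_interference (p : N.Link) :
    Differentiable ℝ fun w : N.Beams => interference w p :=
  (Differentiable.fun_sum fun q _ => (differentiable_gain q p.user).norm_sq ℝ).add_const _

@[fun_prop]
theorem differentiable_sinr (p : N.Link) : Differentiable ℝ fun w : N.Beams => sinr w p := by
  simp only [sinr_eq_div_interference, div_eq_mul_inv]
  exact ((differentiable_gain p p.user).norm_sq ℝ).mul
    ((differentiable_interference p).inv fun w => (interference_pos w p).ne')

@[fun_prop]
theorem differentiable_log_one_add_sinr (p : N.Link) :
    Differentiable ℝ fun w : N.Beams => Real.log (1 + sinr w p) :=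
  ((differentiable_sinr p).const_add 1).log fun w => (one_add_sinr_pos w p).ne'

theorem differentiable_rate (p : N.Link) : Differentiable ℝ fun w : N.Beams => rate w p := by
  simp only [rate_eq_mul_log]
  fun_prop

theorem differentiable_minWmmse : Differentiable ℝ (minWmmse : N.Beams → ℝ) := by
  unfold minWmmse
  fun_prop

theorem sum_fderiv_rate (x v : N.Beams) :
    ∑ p : N.Link, fderiv ℝ (fun w => rate w p) x v =
      -(N.β / Real.log 2 * fderiv ℝ minWmmse x v) := by
  have hsum := HasFDerivAt.fun_sum (u := Finset.univ)
    fun p _ => (differentiable_rate p x).hasFDerivAt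
  simp only [sum_rate_eq_minWmmse] at hsum
  have hminWmmse := ((differentiable_minWmmse x).hasFDerivAt.const_sub
    (Fintype.card N.Link : ℝ)).const_mul (N.β / Real.log 2)
  simpa using congrArg (· v) (hsum.unique hminWmmse)

theorem differentiable_mse (u : N.Link → ℂ) (p : N.Link) :
    Differentiable ℝ fun w : N.Beams => mse u w p := by
  simp only [mse_eq_add_interference]
  exact (((differentiable_gain p p.user).const_mul _).const_sub 1).norm_sq ℝ |>.add
    ((differentiable_interference p).const_mul _)

theorem differentiable_wmmse (lam ρ : N.Link → ℝ) (u : N.Link → ℂ) :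
    Differentiable ℝ (wmmse lam ρ u : N.Beams → ℝ) :=
  Differentiable.fun_sum fun p _ =>
    (((differentiable_mse u p).const_mul (ρ p)).sub_const _).const_mul (lam p)

theorem continuous_mmseReceiver (p : N.Link) :
    Continuous fun v : N.Beams => mmseReceiver v p := by
  have hgain := (differentiable_gain p p.user).continuous
  have hinterference := (differentiable_interference p).continuous
  simp only [mmseReceiver_eq_div_interference]
  refine hgain.div (by fun_prop) fun v => Complex.ofReal_ne_zero.2 ?_
  exact (add_pos_of_nonneg_of_pos (sq_nonneg _) (interference_pos v p)).ne'

theorem continuous_surrogate_left (w : N.Beams) : Continuous fun v => surrogate v w := by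
  simp only [surrogate, wmmse, mse_mmseReceiver, inv_inv]
  simp only [mse_eq_add_interference]
  refine continuous_finsetSum _ fun p _ => ?_
  have hsinr := (differentiable_sinr p).continuous
  have hlog := (differentiable_log_one_add_sinr p).continuous
  have hreceiver := continuous_mmseReceiver p
  fun_prop

theorem continuous_sumRate : Continuous (sumRate : N.Beams → ℝ) := by
  refine continuous_finsetSum _ fun p _ => ?_
  have hrate := (differentiable_rate p).continuous
  split_ifs
  · exact hrate.min continuous_const
  · exact hrate

end Regularity

section Feasible

theorem zero_mem_feasible : (0 : N.Beams) ∈ N.feasible := fun i => by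
  simpa using N.Pmax_nonneg i

theorem mem_feasible_of_norm_le {v w : N.Beams} (hw : w ∈ N.feasible) (h : ∀ p, ‖v p‖ ≤ ‖w p‖) :
    v ∈ N.feasible := fun i =>
  (Finset.sum_le_sum fun p _ => pow_le_pow_left₀ (norm_nonneg _) (h p) 2).trans (hw i)

theorem update_zero_mem_feasible {w : N.Beams} (hw : w ∈ N.feasible) (p : N.Link) :
    Function.update w p 0 ∈ N.feasible := by
  refine mem_feasible_of_norm_le hw fun q => ?_
  rcases eq_or_ne q p with rfl | hne
  · simp
  · rw [Function.update_of_ne hne]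

theorem norm_le_sqrt_of_mem_feasible {w : N.Beams} (hw : w ∈ N.feasible) (p : N.Link) :
    ‖w p‖ ≤ √(N.Pmax p.tx) :=
  Real.le_sqrt_of_sq_le <| (Finset.single_le_sum (f := fun q => ‖w q‖ ^ 2)
    (fun _ _ => sq_nonneg _) (by simp)).trans (hw p.tx)

theorem isClosed_feasible : IsClosed N.feasible := by
  simp only [feasible, Set.ofPred_forall]
  exact isClosed_iInter fun i => isClosed_le (by fun_prop) continuous_const

theorem isCompact_feasible : IsCompact N.feasible := by
  refine (isCompact_univ_pi fun p : N.Link =>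
    isCompact_closedBall (0 : EuclideanSpace ℂ (Fin (N.antennas p.tx))) √(N.Pmax p.tx)
    ).of_isClosed_subset isClosed_feasible fun w hw p _ => ?_
  exact mem_closedBall_zero_iff.2 (norm_le_sqrt_of_mem_feasible hw p)

theorem convexOn_norm_sq_apply (p : N.Link) :
    ConvexOn ℝ Set.univ fun w : N.Beams => ‖w p‖ ^ 2 :=
  (convexOn_univ_norm.pow (fun _ _ => norm_nonneg _) 2).comp_linearMap
    (LinearMap.proj (R := ℝ) (φ := fun p : N.Link => EuclideanSpace ℂ (Fin (N.antennas p.tx))) p)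

theorem convex_feasible : Convex ℝ N.feasible := by
  simp only [feasible, Set.ofPred_forall]
  refine convex_iInter fun i => ?_
  have hconv : ConvexOn ℝ Set.univ
      (∑ p : N.Link with p.tx = i, fun w : N.Beams => ‖w p‖ ^ 2) :=
    Finset.sum_induction _ (ConvexOn ℝ Set.univ) (fun _ _ => ConvexOn.add)
      (convexOn_const 0 convex_univ) fun p _ => convexOn_norm_sq_apply p
  simpa using hconv.convex_le (N.Pmax i)

end Feasible

section Existence

theorem exists_isWeight (w : N.Beams) : ∃ lam, IsWeight w lam := by
  refine ⟨fun p => if p.tx = 0 ∧ N.RFSO ≤ rate w p then 0 else 1,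
    fun p => ⟨fun hp => ?_, fun hp => ?_⟩⟩
  · simp [hp]
  · rcases le_or_gt N.RFSO (rate w p) with hle | hlt
    · exact Or.inr ⟨by simp [hp, hle], min_eq_right hle⟩
    · exact Or.inl ⟨by simp [hlt], min_eq_left hlt.le⟩

theorem exists_isMinOn_wmmse (lam ρ : N.Link → ℝ) (u : N.Link → ℂ) :
    ∃ w ∈ N.feasible, IsMinOn (wmmse lam ρ u) N.feasible w :=
  isCompact_feasible.exists_isMinOn ⟨0, zero_mem_feasible⟩
    (differentiable_wmmse lam ρ u).continuous.continuousOn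

/-- A minimizer with inclusion-minimal set of active links wastes no power. -/
theorem exists_isBeamUpdate (lam ρ : N.Link → ℝ) (u : N.Link → ℂ) :
    ∃ w : N.Beams, IsBeamUpdate lam ρ u w := by
  obtain ⟨w, ⟨hw, hmin⟩, hminimal⟩ := exists_minimalFor_of_wellFoundedLT
    (fun w => w ∈ N.feasible ∧ IsMinOn (wmmse lam ρ u) N.feasible w)
    (fun w => {p | w p ≠ 0}) (exists_isMinOn_wmmse lam ρ u)
  refine ⟨w, hmin, hw, fun p _ heq => by_contra fun hp => ?_⟩
  have hle : {q | Function.update w p 0 q ≠ 0} ≤ {q | w q ≠ 0} := fun q hq hwq => hq <| by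
    rcases eq_or_ne q p with rfl | hne
    · exact Function.update_self ..
    · rwa [Function.update_of_ne hne]
  have hmin' : IsMinOn (wmmse lam ρ u) N.feasible (Function.update w p 0) := fun y hy =>
    heq.trans_le (hmin hy)
  exact hminimal ⟨update_zero_mem_feasible hw p, hmin'⟩ hle hp (Function.update_self ..)

theorem exists_run (w₀ : N.Beams) : ∃ run : N.Run, run.w 0 = w₀ := by
  choose lam hlam using exists_isWeight (N := N)
  choose next hnext using exists_isBeamUpdate (N := N)
  let ρ : N.Beams → N.Link → ℝ := fun w p => (mse (mmseReceiver w) w p)⁻¹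
  let w : ℕ → N.Beams := fun m =>
    Nat.rec w₀ (fun _ v => next (lam v) (ρ v) (mmseReceiver v)) m
  let run : N.Run :=
    { w
      lam := fun m => lam (w m)
      u := fun m => mmseReceiver (w m)
      ρ := fun m => ρ (w m)
      weight_step := fun m => hlam (w m)
      receiver_step := fun _ => rfl
      mse_weight_step := fun _ _ => rfl
      beam_step := fun _ => hnext _ _ _ }
  exact ⟨run, rfl⟩

end Existence

section SwitchingOff

variable {w : N.Beams} {lam ρ : N.Link → ℝ} {u : N.Link → ℂ} {p : N.Link}

theorem norm_gain_update_zero_le (w : N.Beams) (p q : N.Link) (j : Fin N.NU) :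
    ‖gain (Function.update w p 0) q j‖ ≤ ‖gain w q j‖ := by
  rcases eq_or_ne q p with rfl | hne
  · simp [gain]
  · simp [gain, Function.update_of_ne hne]

theorem interference_update_zero_le (w : N.Beams) (p q : N.Link) :
    interference (Function.update w p 0) q ≤ interference w q := by
  unfold interference
  gcongr
  exact norm_gain_update_zero_le w p _ _

theorem mse_update_zero_le {q : N.Link} (w : N.Beams) (h : q ≠ p ∨ u q = 0) :
    mse u (Function.update w p 0) q ≤ mse u w q := by
  simp only [mse_eq_add_interference]
  gcongr ?_ + _ * ?_
  · rcases h with hne | hu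
    · simp [gain, Function.update_of_ne hne]
    · simp [hu]
  · exact interference_update_zero_le w p q

theorem wmmse_update_zero_le (hlam : ∀ q, 0 ≤ lam q) (hρ : ∀ q, 0 ≤ ρ q) (w : N.Beams)
    (h : lam p = 0 ∨ u p = 0) : wmmse lam ρ u (Function.update w p 0) ≤ wmmse lam ρ u w := by
  refine Finset.sum_le_sum fun q _ => ?_
  by_cases hq : lam q = 0
  · simp [hq]
  have hmse : mse u (Function.update w p 0) q ≤ mse u w q := mse_update_zero_le w <|
    or_iff_not_imp_left.2 fun hqp => by
      obtain rfl := not_not.1 hqp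
      exact h.resolve_left hq
  have := hlam q
  have := hρ q
  gcongr

theorem IsBeamUpdate.eq_zero (hw : IsBeamUpdate lam ρ u w) (hlam : ∀ q, 0 ≤ lam q)
    (hρ : ∀ q, 0 ≤ ρ q) (hp : p.tx = 0) (h : lam p = 0 ∨ u p = 0) : w p = 0 := by
  obtain ⟨hmin, hmem, hzero⟩ := hw
  exact hzero p hp <| (wmmse_update_zero_le hlam hρ w h).antisymm <|
    hmin (update_zero_mem_feasible hmem p)

end SwitchingOff

namespace IsWeight

variable {w : N.Beams} {lam : N.Link → ℝ} {p : N.Link}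

theorem eq_zero_or_eq_one (h : IsWeight w lam) (p : N.Link) : lam p = 0 ∨ lam p = 1 := by
  by_cases hp : p.tx = 0
  · exact ((h p).2 hp).symm.imp And.left And.left
  · exact Or.inr ((h p).1 hp)

theorem nonneg (h : IsWeight w lam) (p : N.Link) : 0 ≤ lam p := by
  rcases h.eq_zero_or_eq_one p with hp | hp <;> simp [hp]

theorem tx_eq_zero (h : IsWeight w lam) (hp : lam p = 0) : p.tx = 0 :=
  by_contra fun htx => zero_ne_one (hp.symm.trans ((h p).1 htx))

theorem RFSO_le_rate (h : IsWeight w lam) (hp : lam p = 0) : N.RFSO ≤ rate w p := by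
  rcases (h p).2 (h.tx_eq_zero hp) with ⟨hone, -⟩ | ⟨-, htau⟩
  · exact absurd (hp.symm.trans hone) zero_ne_one
  · exact min_eq_right_iff.1 htau

theorem rate_le (h : IsWeight w lam) (htx : p.tx = 0) (hp : lam p = 1) :
    rate w p ≤ N.RFSO := by
  rcases (h p).2 htx with ⟨-, htau⟩ | ⟨hzero, -⟩
  · exact min_eq_left_iff.1 htau
  · exact absurd (hzero.symm.trans hp) zero_ne_one

theorem eq_one_of_eq_zero (h : IsWeight w lam) (hw : w p = 0) : lam p = 1 := by
  refine (h.eq_zero_or_eq_one p).resolve_left fun hp => N.RFSO_pos.not_ge ?_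
  calc
    N.RFSO ≤ rate w p := h.RFSO_le_rate hp
    _ = 0 := by simp [rate, sinr, gain, hw]

theorem sumRate_eq (h : IsWeight w lam) (hlam : lam = 1) :
    sumRate w = N.β / Real.log 2 * (Fintype.card N.Link - minWmmse w) := by
  rw [← sum_rate_eq_minWmmse, sumRate]
  refine Finset.sum_congr rfl fun p _ => ite_eq_right_iff.2 fun hp => ?_
  exact min_eq_left (h.rate_le hp (congrFun hlam p))

end IsWeight

theorem isStationary_of_fderiv_minWmmse_nonneg {x : N.Beams} (hx : x ∈ N.feasible)
    (hcap : ∀ p : N.Link, p.tx = 0 → rate x p ≤ N.RFSO)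
    (hderiv : ∀ y ∈ N.feasible, 0 ≤ fderiv ℝ minWmmse x (y - x)) : IsStationary x := by
  refine ⟨hx, fun y hy => ?_⟩
  have hrate (p : N.Link) :=
    ((differentiable_rate p x).hasFDerivAt.hasLineDerivAt (y - x)).hasDerivWithinAt
      (s := Set.Ici 0)
  have hterm (p : N.Link) : ∃ D ≤ fderiv ℝ (rate · p) x (y - x), HasDerivWithinAt
      (fun t : ℝ => if p.tx = 0 then tau (x + t • (y - x)) p else rate (x + t • (y - x)) p)
      D (Set.Ici 0) 0 := by
    by_cases hp : p.tx = 0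
    · simp only [if_pos hp]
      exact exists_hasDerivWithinAt_min_const (hrate p) (by simpa using hcap p hp)
    · simp only [if_neg hp]
      exact ⟨_, le_rfl, hrate p⟩
  choose D hDle hD using hterm
  refine ⟨∑ p, D p, ?_, HasDerivWithinAt.fun_sum fun p _ => hD p⟩
  calc
    ∑ p, D p ≤ ∑ p, fderiv ℝ (rate · p) x (y - x) := Finset.sum_le_sum fun p _ => hDle p
    _ = -(N.β / Real.log 2 * fderiv ℝ minWmmse x (y - x)) := sum_fderiv_rate x (y - x)
    _ ≤ 0 := neg_nonpos.2 <|
      mul_nonneg (div_nonneg N.β_pos.le (Real.log_nonneg one_le_two)) (hderiv y hy)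

namespace Run

variable (run : N.Run)

theorem ρ_eq (m : ℕ) : run.ρ m = fun p => (mse (mmseReceiver (run.w m)) (run.w m) p)⁻¹ := by
  funext p
  rw [run.mse_weight_step, run.receiver_step]

theorem ρ_nonneg (m : ℕ) (p : N.Link) : 0 ≤ run.ρ m p := by
  rw [run.mse_weight_step, run.receiver_step, mse_mmseReceiver, inv_inv]
  exact (one_add_sinr_pos _ p).le

theorem eventually_mem_feasible : ∀ᶠ m in atTop, run.w m ∈ N.feasible :=
  eventually_atTop.2 ⟨1, Nat.le_induction (run.beam_step 0).2.1 fun m _ _ => (run.beam_step m).2.1⟩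

theorem w_succ_eq_zero {m : ℕ} {p : N.Link} (hp : p.tx = 0)
    (h : run.lam m p = 0 ∨ run.w m p = 0) : run.w (m + 1) p = 0 :=
  (run.beam_step m).eq_zero (run.weight_step m).nonneg (run.ρ_nonneg m) hp <|
    h.imp_right fun hw => run.receiver_step m ▸ mmseReceiver_eq_zero hw

theorem w_eq_zero_of_lam_eq_zero {m k : ℕ} {p : N.Link} (hp : run.lam m p = 0) (hmk : m < k) :
    run.w k p = 0 := by
  have htx : p.tx = 0 := (run.weight_step m).tx_eq_zero hp
  induction k, hmk using Nat.le_induction with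
  | base => exact run.w_succ_eq_zero htx (Or.inl hp)
  | succ k _ ih => exact run.w_succ_eq_zero htx (Or.inr ih)

theorem eventually_lam_eq_one : ∀ᶠ m in atTop, run.lam m = 1 := by
  simp only [funext_iff, Pi.one_apply]
  refine eventually_all.2 fun p => ?_
  by_cases hzero : ∃ m, run.lam m p = 0
  · obtain ⟨m, hm⟩ := hzero
    filter_upwards [eventually_gt_atTop m] with k hk
    exact (run.weight_step k).eq_one_of_eq_zero (run.w_eq_zero_of_lam_eq_zero hm hk)
  · exact Eventually.of_forall fun m =>
      ((run.weight_step m).eq_zero_or_eq_one p).resolve_left (not_exists.1 hzero m)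

theorem eventually_isMinOn_surrogate :
    ∀ᶠ m in atTop, IsMinOn (surrogate (run.w m)) N.feasible (run.w (m + 1)) := by
  filter_upwards [run.eventually_lam_eq_one] with m hlam
  have hmin := (run.beam_step m).1
  rwa [hlam, run.ρ_eq, run.receiver_step] at hmin

theorem exists_tendsto_minWmmse : ∃ L, Tendsto (fun m => minWmmse (run.w m)) atTop (𝓝 L) :=
  isMajorizer_surrogate.exists_tendsto
    (isCompact_feasible.bddBelow_image differentiable_minWmmse.continuous.continuousOn)
    run.eventually_mem_feasible run.eventually_isMinOn_surrogate

theorem exists_tendsto_sumRate : ∃ L, Tendsto (fun m => sumRate (run.w m)) atTop (𝓝 L) := by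
  obtain ⟨L, hL⟩ := run.exists_tendsto_minWmmse
  refine ⟨_, ((hL.const_sub (Fintype.card N.Link : ℝ)).const_mul (N.β / Real.log 2)).congr' ?_⟩
  filter_upwards [run.eventually_lam_eq_one] with m hlam
  exact ((run.weight_step m).sumRate_eq hlam).symm

variable {run} {x : N.Beams}

theorem mem_feasible_of_mapClusterPt (hx : MapClusterPt x atTop run.w) : x ∈ N.feasible :=
  isClosed_feasible.mem_of_mapClusterPt hx run.eventually_mem_feasible

theorem rate_le_of_mapClusterPt (hx : MapClusterPt x atTop run.w) {p : N.Link} (hp : p.tx = 0) :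
    rate x p ≤ N.RFSO :=
  (isClosed_le (differentiable_rate p).continuous continuous_const).mem_of_mapClusterPt hx <|
    run.eventually_lam_eq_one.mono fun m hlam =>
      (run.weight_step m).rate_le hp (congrFun hlam p)

theorem isMinOn_surrogate_of_mapClusterPt (hx : MapClusterPt x atTop run.w) :
    IsMinOn (surrogate x) N.feasible x := by
  obtain ⟨L, hL⟩ := run.exists_tendsto_minWmmse
  exact isMajorizer_surrogate.isMinOn_of_mapClusterPt
    differentiable_minWmmse.continuous.continuousAt
    (fun y _ => (continuous_surrogate_left y).continuousAt) run.eventually_isMinOn_surrogate hL hx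

theorem isStationary_of_mapClusterPt (hx : MapClusterPt x atTop run.w) : IsStationary x := by
  have hmem : x ∈ N.feasible := mem_feasible_of_mapClusterPt hx
  refine isStationary_of_fderiv_minWmmse_nonneg hmem
    (fun p hp => rate_le_of_mapClusterPt hx hp) fun y hy => ?_
  exact isMajorizer_surrogate.fderiv_nonneg_of_isMinOn (differentiable_minWmmse x)
    (differentiable_wmmse _ _ _ x) convex_feasible hmem (isMinOn_surrogate_of_mapClusterPt hx) hy

variable (run)

theorem exists_mapClusterPt : ∃ x, MapClusterPt x atTop run.w := by
  obtain ⟨x, -, hx⟩ := isCompact_feasible.exists_mapClusterPt_of_frequently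
    run.eventually_mem_feasible.frequently
  exact ⟨x, hx⟩

theorem tendsto_infDist_isStationary :
    Tendsto (fun m => Metric.infDist (run.w m) {x : N.Beams | IsStationary x}) atTop (𝓝 0) :=
  (tendsto_infDist_nhdsSet _).comp <|
    isCompact_feasible.tendsto_nhdsSet_of_mapClusterPt run.eventually_mem_feasible
      fun _ _ hx => isStationary_of_mapClusterPt hx

end Run

end Network

theorem lemma1 (N : Network) (w₀ : N.Beams) :
    (∃ run : N.Run, run.w 0 = w₀) ∧
    ∀ run : N.Run, run.w 0 = w₀ →
      (∃ x, MapClusterPt x atTop run.w) ∧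
      (∃ L : ℝ, Tendsto (fun m => Network.sumRate (run.w m)) atTop (𝓝 L) ∧
        ∀ x, MapClusterPt x atTop run.w → Network.IsStationary x ∧ Network.sumRate x = L) ∧
      Tendsto (fun m => Metric.infDist (run.w m) {x : N.Beams | Network.IsStationary x})
        atTop (𝓝 0) := by
  refine ⟨Network.exists_run w₀, fun run _ =>
    ⟨run.exists_mapClusterPt, ?_, run.tendsto_infDist_isStationary⟩⟩
  obtain ⟨L, hL⟩ := run.exists_tendsto_sumRate
  exact ⟨L, hL, fun x hx => ⟨Network.Run.isStationary_of_mapClusterPt hx,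
    map_eq_of_mapClusterPt hx Network.continuous_sumRate.continuousAt hL⟩⟩
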